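/- Let $(R,\mathfrak m)$ be a Cohen--Macaulay local ring (commutative and Noetherian, with $\operatorname{depth} R=\dim R$). A finitely generated $R$-module $N$ is called maximal Cohen--Macaulay (MCM) if $\operatorname{depth} N=\dim R$; the zero module, whose depth is $\infty$, is not MCM. With $d=\dim R$, the multiplicity of a finitely generated $R$-module $N$ is $$e(N)=\lim_{k\to\infty}\frac{d!\,\ell_R(N/\mathfrak m^kN)}{k^d}.$$ Let $M$ be an MCM $R$-module, let $n=\mu(M)$ be its minimal number of generators, and let $e=e(R)$ be the multiplicity of $R$. If there are only finitely many isomorphism classes of indecomposable MCM $R$-modules $N$ with $e(N)\le n\cdot e$, then the $R_{\mathfrak p}$-module $M_{\mathfrak p}$ is free for every prime ideal $\mathfrak p\neq\mathfrak m$ of $R$. -/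

import Mathlib

open IsLocalRing Filter Topology

universe u v

namespace LocalCM

/-- The depth of a module `M` over a local ring `(R, 𝔪)`: the supremum of the lengths of the
`M`-regular sequences contained in `𝔪`. For finitely generated `M ≠ 0` the condition
`M ≠ (x₁, …, xₙ) M` in the definition of a regular sequence is automatic by Nakayama's lemma;
leaving it out gives the zero module infinite depth, as usual. -/
noncomputable def depth (R : Type u) [CommRing R] [IsLocalRing R]
    (M : Type v) [AddCommGroup M] [Module R M] : ℕ∞ :=
  ⨆ rs : {rs : List R //
    (∀ r ∈ rs, r ∈ maximalIdeal R) ∧ RingTheory.Sequence.IsWeaklyRegular M rs},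
    (rs.1.length : ℕ∞)

/-- Maximal Cohen-Macaulay modules: finitely generated with `depth M = dim R`.
The zero module is not MCM, because it has infinite depth. -/
def IsMCM (R : Type u) [CommRing R] [IsLocalRing R]
    (M : Type v) [AddCommGroup M] [Module R M] : Prop :=
  Module.Finite R M ∧ (depth R M : WithBot ℕ∞) = ringKrullDim R

/-- A Noetherian local ring is Cohen-Macaulay when `depth R = dim R`. -/
def IsCMLocalRing (R : Type u) [CommRing R] [IsLocalRing R] : Prop :=
  IsNoetherianRing R ∧ (depth R R : WithBot ℕ∞) = ringKrullDim R

/-- The Krull dimension as a natural number (it is finite for a Noetherian local ring). -/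
noncomputable def dim (R : Type u) [CommRing R] : ℕ :=
  ((ringKrullDim R).unbotD 0).toNat

/-- The Hilbert-Samuel function `k ↦ ℓ(M / 𝔪ᵏ M)` (the length is finite for a finitely generated
module over a Noetherian local ring). -/
noncomputable def hilbertSamuel (R : Type u) [CommRing R] [IsLocalRing R]
    (M : Type v) [AddCommGroup M] [Module R M] (k : ℕ) : ℕ :=
  (Module.length R (M ⧸ (maximalIdeal R ^ k • (⊤ : Submodule R M)))).toNat

/-- The multiplicity `e(M) = lim_{k → ∞} d! ℓ(M / 𝔪ᵏ M) / kᵈ`, where `d = dim R`. -/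
noncomputable def mult (R : Type u) [CommRing R] [IsLocalRing R]
    (M : Type v) [AddCommGroup M] [Module R M] : ℝ :=
  limUnder atTop fun k : ℕ =>
    ((dim R).factorial : ℝ) * (hilbertSamuel R M k : ℝ) / (k : ℝ) ^ dim R

/-- The minimal number `μ(M)` of generators. -/
noncomputable def minGens (R : Type u) [CommRing R]
    (M : Type v) [AddCommGroup M] [Module R M] : ℕ :=
  (⊤ : Submodule R M).spanFinrank

/-- A nonzero module is indecomposable when it is not the direct sum of two nonzero submodules. -/
def IsIndecomposable (R : Type u) [CommRing R]
    (M : Type v) [AddCommGroup M] [Module R M] : Prop :=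
  Nontrivial M ∧ ∀ p q : Submodule R M, IsCompl p q → p = ⊥ ∨ q = ⊥

/-- The isomorphism classes of indecomposable MCM `R`-modules of multiplicity at most `b`.
Every finitely generated `R`-module is isomorphic to one in the universe of `R`. -/
def indecMCMClasses (R : Type u) [CommRing R] [IsLocalRing R] (b : ℝ) :
    Set (Quotient (CategoryTheory.isIsomorphicSetoid (ModuleCat.{u} R))) :=
  Quotient.mk _ '' {N : ModuleCat.{u} R |
    IsMCM R N ∧ IsIndecomposable R N ∧ mult R N ≤ b}

end LocalCM

/-! ### Extending maps along an extension: a length count -/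

section Lifting

variable {R : Type u} [CommRing R]

/-! Take a surjection F = R^n → M with kernel K, and c ∈ 𝔪 outside p. Let X_i be the pushout of 0 →
K → F → M → 0 along c^i on K. It is an extension of M by K, so it inherits their depth. By
Artin–Rees (`LocalCM.exists_hilbertSamuel_le`) its Hilbert–Samuel function is at most n times a
fixed shift of that of R. Hence every indecomposable summand of X_i is MCM of multiplicity at most
n·e. The number of summands is bounded independently of i, so the X_i fall into finitely many
isomorphism classes, and some X_j is isomorphic to X_i for infinitely many i.

A length count now replaces any compatibility of these isomorphisms with the extensions
(`LinearMap.lcomp_surjective_of_linearEquiv`). For L = K/𝔪^s K and i > s, c^i kills L, so every map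
K → L extends to X_i. Comparing the lengths of Hom(X_i, L) and Hom(X_j, L), every map K → L extends
to X_j, which means that c^j times it extends to F. Since s is arbitrary, Artin–Rees and Krull's
intersection theorem extend c^j on K itself to a map F → K
(`Submodule.exists_extension_of_forall_modulo`). As c is a unit in R_p, F → M splits there.

Since `mult` is a `limUnder`, the limit must also be shown to exist; this is the Hilbert–Samuel
part. -/

theorem Module.length_linearMap_ne_top {A L : Type*} [AddCommGroup A] [Module R A]
    [Module.Finite R A] [AddCommGroup L] [Module R L] (hL : Module.length R L ≠ ⊤) :
    Module.length R (A →ₗ[R] L) ≠ ⊤ := by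
  obtain ⟨n, f, hf⟩ := Module.Finite.exists_fin' R A
  have h1 : Module.length R (A →ₗ[R] L) ≤ Module.length R ((Fin n → R) →ₗ[R] L) :=
    Module.length_le_of_injective (LinearMap.lcomp R L f)
      (fun a b h => LinearMap.cancel_right hf |>.1 h)
  rw [((Pi.basisFun R (Fin n)).constr R (M' := L)).symm.length_eq, Module.length_pi,
    ENat.card_eq_coe_fintype_card] at h1
  exact ne_top_of_le_ne_top (WithTop.mul_ne_top (ENat.natCast_ne_top _) hL) h1

variable {A B B' C L : Type*} [AddCommGroup A] [AddCommGroup B] [AddCommGroup B'] [AddCommGroup C]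
  [AddCommGroup L] [Module R A] [Module R B] [Module R B'] [Module R C] [Module R L]

/-- Left exactness of Hom(-, L); the range stands in for Hom(A, L) because restriction to A need not
be surjective. -/
theorem Module.length_linearMap_eq_add_length_range_lcomp {i : A →ₗ[R] B} {p : B →ₗ[R] C}
    (hp : Function.Surjective p) (hip : Function.Exact i p) :
    Module.length R (B →ₗ[R] L) = Module.length R (C →ₗ[R] L) +
      Module.length R (LinearMap.range (LinearMap.lcomp R L i)) := by
  refine Module.length_eq_add_of_exact (LinearMap.lcomp R L p)
    (LinearMap.lcomp R L i).rangeRestrict (fun a b h => LinearMap.cancel_right hp |>.1 h)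
    (LinearMap.surjective_rangeRestrict _) ?_
  intro g
  constructor
  · intro h
    have h' : g ∘ₗ i = 0 := congrArg Subtype.val h
    have hk : LinearMap.ker p ≤ LinearMap.ker g := by
      intro x hx
      obtain ⟨a, rfl⟩ := (hip x).1 hx
      exact LinearMap.congr_fun h' a
    refine ⟨((LinearMap.ker p).liftQ g hk) ∘ₗ (p.quotKerEquivOfSurjective hp).symm.toLinearMap, ?_⟩
    ext x
    have : (p.quotKerEquivOfSurjective hp).symm (p x) = (LinearMap.ker p).mkQ x := by
      rw [LinearEquiv.symm_apply_eq]; rfl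
    simp [LinearMap.lcomp, this]
  · rintro ⟨g, rfl⟩
    apply Subtype.ext
    ext x
    change g (p (i x)) = 0
    rw [hip.apply_apply_eq_zero, map_zero]

/-- If the middle terms of two extensions of `C` by `A` are isomorphic and every map from `A` to
the module `L` of finite length extends along the first one, then also along the second one. -/
theorem LinearMap.lcomp_surjective_of_linearEquiv [Module.Finite R A] [Module.Finite R C]
    (hL : Module.length R L ≠ ⊤)
    {i : A →ₗ[R] B} {p : B →ₗ[R] C} (hp : Function.Surjective p) (hip : Function.Exact i p)
    {i' : A →ₗ[R] B'} {p' : B' →ₗ[R] C} (hp' : Function.Surjective p') (hip' : Function.Exact i' p')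
    (e : B ≃ₗ[R] B') (hi : Function.Surjective (LinearMap.lcomp R L i)) :
    Function.Surjective (LinearMap.lcomp R L i') := by
  have h1 := Module.length_linearMap_eq_add_length_range_lcomp (L := L) hp hip
  have h2 := Module.length_linearMap_eq_add_length_range_lcomp (L := L) hp' hip'
  rw [LinearMap.range_eq_top.2 hi, Module.length_top, (e.congrLeft L R).length_eq, h2] at h1
  have hA := Module.length_linearMap_ne_top (R := R) (A := A) hL
  have hC := Module.length_linearMap_ne_top (R := R) (A := C) hL
  -- The range of restriction along `i'` has the same finite length as Hom(A, L), so its cokernel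
  -- has length 0.
  have h3 := (ENat.addLECancellable_of_ne_top hC).inj.1 h1
  have h4 := Module.length_eq_add_of_exact
    (LinearMap.range (LinearMap.lcomp R L i')).subtype
    (LinearMap.range (LinearMap.lcomp R L i')).mkQ
    (Submodule.subtype_injective _) (Submodule.mkQ_surjective _) (LinearMap.exact_subtype_mkQ _)
  rw [h3] at h4
  have h5 : Module.length R ((A →ₗ[R] L) ⧸ (LinearMap.range (LinearMap.lcomp R L i'))) = 0 := by
    have : Module.length R (A →ₗ[R] L) + 0 = Module.length R (A →ₗ[R] L) +
      Module.length R ((A →ₗ[R] L) ⧸ (LinearMap.range (LinearMap.lcomp R L i'))) := by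
      rw [add_zero]; exact h4
    exact ((ENat.addLECancellable_of_ne_top hA).inj.1 this).symm
  rw [Module.length_eq_zero_iff, Submodule.Quotient.subsingleton_iff] at h5
  exact LinearMap.range_eq_top.1 h5

end Lifting

/-! ### Multiples of an extension class as pushouts -/

section Pushout

variable {R : Type u} [CommRing R] {F : Type u} [AddCommGroup F] [Module R F]

/-- The pushout of the inclusion `K → F` along the multiplication by `c` on `K`. -/
abbrev SMulPushout (K : Submodule R F) (c : R) : Type u :=
  (F × K) ⧸ LinearMap.range (K.subtype.prod (-(c • LinearMap.id : K →ₗ[R] K)))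

namespace SMulPushout

variable (K : Submodule R F) (c : R)

/-- The inclusion of `K` into the pushout. -/
def inr : K →ₗ[R] SMulPushout K c := Submodule.mkQ _ ∘ₗ LinearMap.inr R F K

/-- The projection from the pushout to `F ⧸ K`. -/
def proj : SMulPushout K c →ₗ[R] F ⧸ K :=
  Submodule.liftQ _ (K.mkQ ∘ₗ LinearMap.fst R F K) (by
    rintro _ ⟨x, rfl⟩
    simp)

theorem proj_surjective : Function.Surjective (proj K c) := by
  intro y
  obtain ⟨x, rfl⟩ := K.mkQ_surjective y
  exact ⟨Submodule.mkQ _ (x, 0), by simp [proj]⟩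

theorem inr_injective : Function.Injective (inr K c) := by
  rw [← LinearMap.ker_eq_bot, LinearMap.ker_eq_bot']
  intro x hx
  simp only [inr, LinearMap.comp_apply, Submodule.mkQ_apply, Submodule.Quotient.mk_eq_zero] at hx
  obtain ⟨y, hy⟩ := hx
  have : y = 0 := Subtype.ext (congrArg Prod.fst hy)
  have h2 : (-(c • LinearMap.id : K →ₗ[R] K)) y = x := congrArg Prod.snd hy
  rw [← h2, this, map_zero]

theorem exact : Function.Exact (inr K c) (proj K c) := by
  intro y
  obtain ⟨⟨f, k⟩, rfl⟩ := Submodule.mkQ_surjective _ y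
  constructor
  · intro h
    have hf : f ∈ K := by simpa [proj] using h
    refine ⟨k + c • ⟨f, hf⟩, ?_⟩
    simp only [inr, LinearMap.comp_apply]
    rw [← sub_eq_zero, ← map_sub, Submodule.mkQ_apply, Submodule.Quotient.mk_eq_zero]
    exact ⟨-⟨f, hf⟩, by ext <;> simp⟩
  · rintro ⟨k, h⟩
    rw [← h]
    simp [inr, proj]

/-- Universal property: a map out of the pushout restricting to `g` is a map `f` on F that agrees
with `c • g` on K. -/
theorem exists_extension_iff {L : Type*} [AddCommGroup L] [Module R L] (g : K →ₗ[R] L) :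
    g ∈ LinearMap.range (LinearMap.lcomp R L (inr K c)) ↔
      ∃ f : F →ₗ[R] L, f ∘ₗ K.subtype = c • g := by
  constructor
  · rintro ⟨h, rfl⟩
    refine ⟨h ∘ₗ Submodule.mkQ _ ∘ₗ LinearMap.inl R F K, ?_⟩
    ext k
    simp only [LinearMap.comp_apply, LinearMap.smul_apply, LinearMap.lcomp_apply, inr,
      ← map_smul]
    congr 1
    rw [← sub_eq_zero, ← map_sub, Submodule.mkQ_apply, Submodule.Quotient.mk_eq_zero]
    exact ⟨k, by ext <;> simp⟩
  · rintro ⟨f, hf⟩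
    refine ⟨Submodule.liftQ _ (f.coprod g) ?_, ?_⟩
    · rintro _ ⟨k, rfl⟩
      have := LinearMap.congr_fun hf k
      simp only [LinearMap.comp_apply, Submodule.subtype_apply, LinearMap.smul_apply] at this
      simp [this]
    · ext k
      simp [inr]

/-- Since `c` kills L, the zero map on F extends `c • g`, so restriction from the first pushout is
surjective; the length count transfers this to the second. -/
theorem extension_of_linearEquiv [Module.Finite R K] [Module.Finite R F] {c' : R}
    {L : Type*} [AddCommGroup L] [Module R L]
    (hL : Module.length R L ≠ ⊤) (hc : ∀ x : L, c • x = 0)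
    (e : SMulPushout K c ≃ₗ[R] SMulPushout K c') (g : K →ₗ[R] L) :
    ∃ f : F →ₗ[R] L, f ∘ₗ K.subtype = c' • g := by
  have hs : Function.Surjective (LinearMap.lcomp R L (inr K c)) := fun g =>
    (exists_extension_iff K c g).2 ⟨0, by ext k; simp [hc]⟩
  exact (exists_extension_iff K c' g).1
    (LinearMap.lcomp_surjective_of_linearEquiv hL (proj_surjective K c) (exact K c)
      (proj_surjective K c') (exact K c') e hs g)

end SMulPushout

end Pushout

/-! ### Artin–Rees for modules of homomorphisms -/

section ArtinRees

variable {R : Type u} [CommRing R]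

theorem Submodule.mem_ideal_smul_top_pi {ι : Type*} [Fintype ι] {A : Type*} [AddCommGroup A]
    [Module R A] (I : Ideal R) (w : ι → A) (hw : ∀ i, w i ∈ I • (⊤ : Submodule R A)) :
    w ∈ I • (⊤ : Submodule R (ι → A)) := by
  classical
  rw [← Finset.univ_sum_single w]
  refine Submodule.sum_mem _ fun i _ => ?_
  have : Submodule.map (LinearMap.single R (fun _ : ι => A) i) (I • ⊤) ≤ I • ⊤ := by
    rw [Submodule.map_smul'']
    exact Submodule.smul_mono le_rfl le_top
  exact this ⟨w i, hw i, rfl⟩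

variable [IsNoetherianRing R]

/-- Maps with values in a high power `I ^ s • B` are themselves in a high power of `I`. -/
theorem LinearMap.exists_forall_mem_pow_smul_top (I : Ideal R) (A B : Type*)
    [AddCommGroup A] [Module R A] [Module.Finite R A]
    [AddCommGroup B] [Module R B] [Module.Finite R B] :
    ∃ k : ℕ, ∀ n, ∀ f : A →ₗ[R] B, (∀ x, f x ∈ I ^ (n + k) • (⊤ : Submodule R B)) →
      f ∈ I ^ n • (⊤ : Submodule R (A →ₗ[R] B)) := by
  obtain ⟨t, s, hs⟩ := Module.Finite.exists_fin (R := R) (M := A)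
  -- Evaluation at generators embeds Hom(A, B) in B^t; Artin–Rees is applied to its image.
  let ev : (A →ₗ[R] B) →ₗ[R] (Fin t → B) := LinearMap.pi fun i => LinearMap.applyₗ (s i)
  have hev : Function.Injective ev := by
    intro f g h
    refine LinearMap.ext_on_range hs fun i => ?_
    exact congrFun h i
  obtain ⟨k, hk⟩ := Ideal.exists_pow_inf_eq_pow_smul I (LinearMap.range ev)
  refine ⟨k, fun n f hf => ?_⟩
  have h1 : ev f ∈ I ^ (n + k) • (⊤ : Submodule R (Fin t → B)) ⊓ LinearMap.range ev :=
    ⟨Submodule.mem_ideal_smul_top_pi _ _ fun i => hf (s i), f, rfl⟩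
  rw [hk (n + k) (Nat.le_add_left _ _), Nat.add_sub_cancel] at h1
  have h2 : ev f ∈ I ^ n • LinearMap.range ev := Submodule.smul_mono le_rfl inf_le_right h1
  rw [← Submodule.map_top, ← Submodule.map_smul''] at h2
  obtain ⟨g, hg, hgf⟩ := h2
  rwa [← hev hgf]

variable [IsLocalRing R]

/-- The class of `g` modulo the extendable maps lies in every 𝔪^n multiple of the quotient of Hom(K,
B), so it vanishes by Krull's intersection theorem. -/
theorem Submodule.exists_extension_of_forall_modulo {F : Type*} [AddCommGroup F] [Module R F]
    [Module.Finite R F] (K : Submodule R F) {B : Type*} [AddCommGroup B] [Module R B]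
    [Module.Finite R B] (g : K →ₗ[R] B)
    (h : ∀ s : ℕ, ∃ f : F →ₗ[R] B, ∀ x : K, g x - f x ∈ maximalIdeal R ^ s • (⊤ : Submodule R B)) :
    ∃ f : F →ₗ[R] B, f ∘ₗ K.subtype = g := by
  let S := LinearMap.range (LinearMap.lcomp R B K.subtype)
  suffices g ∈ S by
    obtain ⟨f, hf⟩ := this
    exact ⟨f, hf⟩
  obtain ⟨k, hk⟩ := LinearMap.exists_forall_mem_pow_smul_top (maximalIdeal R) K B
  rw [← Submodule.Quotient.mk_eq_zero, ← Submodule.mem_bot R,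
    ← Ideal.iInf_pow_smul_eq_bot_of_isLocalRing (maximalIdeal R) (Ideal.IsPrime.ne_top inferInstance),
    Submodule.mem_iInf]
  intro n
  obtain ⟨f, hf⟩ := h (n + k)
  have h1 := hk n (g - f ∘ₗ K.subtype) hf
  have h2 : (Submodule.Quotient.mk g : (K →ₗ[R] B) ⧸ S) = S.mkQ (g - f ∘ₗ K.subtype) := by
    have h3 : S.mkQ (f ∘ₗ K.subtype) = 0 := (Submodule.Quotient.mk_eq_zero S).2 ⟨f, rfl⟩
    rw [map_sub, h3, sub_zero, Submodule.mkQ_apply]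
  rw [h2]
  have h3 : Submodule.map S.mkQ (maximalIdeal R ^ n • ⊤) ≤ maximalIdeal R ^ n • ⊤ := by
    rw [Submodule.map_smul'']
    exact Submodule.smul_mono le_rfl le_top
  exact h3 ⟨_, h1, rfl⟩

end ArtinRees

/-! ### Finite length of modules killed by a power of 𝔪 -/

section FiniteLength

variable {R : Type u} [CommRing R] [IsNoetherianRing R] [IsLocalRing R]

theorem Module.length_ne_top_of_pow_smul_eq_zero {L : Type*} [AddCommGroup L] [Module R L]
    [Module.Finite R L] (s : ℕ) (h : ∀ r ∈ maximalIdeal R ^ s, ∀ x : L, r • x = 0) :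
    Module.length R L ≠ ⊤ := by
  induction s generalizing L with
  | zero =>
    have : Subsingleton L := subsingleton_of_forall_eq 0 fun x => by
      simpa using h 1 (by simp) x
    rw [Module.length_eq_zero]
    exact ENat.zero_ne_top
  | succ s ih =>
    let N : Submodule R L := maximalIdeal R • ⊤
    rw [Module.length_eq_add_of_exact N.subtype N.mkQ N.injective_subtype N.mkQ_surjective
      (LinearMap.exact_subtype_mkQ N)]
    refine WithTop.add_ne_top.2 ⟨ih (L := N) ?_, ?_⟩
    · rintro r hr ⟨x, hx⟩
      apply Subtype.ext
      change r • x = 0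
      have : ∀ y ∈ N, r • y = 0 := by
        intro y hy
        refine Submodule.smul_induction_on hy (fun a ha z _ => ?_) (fun a b ha hb => ?_)
        · rw [smul_smul]
          exact h _ (by rw [pow_succ]; exact Ideal.mul_mem_mul hr ha) z
        · rw [smul_add, ha, hb, add_zero]
      exact this x hx
    · have hk : Module.IsTorsionBySet R (L ⧸ N) (maximalIdeal R) :=
        Module.isTorsionBySet_quotient_ideal_smul L (maximalIdeal R)
      let _ : Module (R ⧸ maximalIdeal R) (L ⧸ N) := hk.module
      have : IsScalarTower R (R ⧸ maximalIdeal R) (L ⧸ N) := hk.isScalarTower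
      let _ : Field (R ⧸ maximalIdeal R) := Ideal.Quotient.field _
      have : Module.Finite (R ⧸ maximalIdeal R) (L ⧸ N) :=
        Module.Finite.of_restrictScalars_finite R _ _
      rw [Module.length_eq_of_surjective (S := R) (R := R ⧸ maximalIdeal R)
        Ideal.Quotient.mk_surjective]
      exact Module.length_ne_top

theorem Module.length_quotient_pow_smul_ne_top (L : Type*) [AddCommGroup L] [Module R L]
    [Module.Finite R L] (s : ℕ) :
    Module.length R (L ⧸ (maximalIdeal R ^ s • (⊤ : Submodule R L))) ≠ ⊤ := by
  refine Module.length_ne_top_of_pow_smul_eq_zero s fun r hr x => ?_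
  obtain ⟨x, rfl⟩ := Submodule.mkQ_surjective _ x
  rw [← map_smul, Submodule.mkQ_apply, Submodule.Quotient.mk_eq_zero]
  exact Submodule.smul_mem_smul hr trivial

end FiniteLength

/-! ### Freeness at p from a splitting up to a scalar outside p -/

section Splitting

variable {R : Type u} [CommRing R]

/-- After localizing, `c` is a unit and π splits, so the localization is finite projective over a
local ring. -/
theorem LocalizedModule.free_of_comp_eq_smul (p : Ideal R) [p.IsPrime] {c : R} (hc : c ∉ p)
    {F M : Type*} [AddCommGroup F] [Module R F] [AddCommGroup M] [Module R M]
    [Module.Finite R F] [Module.Free R F] (π : F →ₗ[R] M) (h : M →ₗ[R] F)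
    (hh : π ∘ₗ h = c • LinearMap.id) :
    Module.Free (Localization.AtPrime p) (LocalizedModule p.primeCompl M) := by
  let S := p.primeCompl
  let A := Localization.AtPrime p
  let mF := LocalizedModule.mkLinearMap S F
  let mM := LocalizedModule.mkLinearMap S M
  let π' := LocalizedModule.map S π
  let h' := LocalizedModule.map S h
  have hu : IsUnit (algebraMap R A c) := IsLocalization.map_units A (⟨c, hc⟩ : S)
  obtain ⟨u, hu⟩ := hu
  have key : ∀ x, π' (h' x) = (u : A) • x := by
    intro x
    induction x using LocalizedModule.induction_on with
    | _ m s =>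
      simp only [π', h', LocalizedModule.map_mk, hu]
      rw [← LinearMap.comp_apply, hh]
      simp [algebraMap_smul, LocalizedModule.smul'_mk]
  have key2 : π' ∘ₗ (((u⁻¹ : Aˣ) : A) • h') = LinearMap.id := by
    ext x
    simp only [LinearMap.comp_apply, LinearMap.smul_apply, map_smul, key, LinearMap.id_apply,
      smul_smul, Units.inv_mul, one_smul]
  have : Module.Projective A (LocalizedModule S M) := Module.Projective.of_split _ _ key2
  have hs : Function.Surjective π' := fun x => ⟨_, LinearMap.congr_fun key2 x⟩
  have : Module.Finite A (LocalizedModule S M) := Module.Finite.of_surjective π' hs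
  exact Module.free_of_flat_of_isLocalRing

/-- If multiplication by `c ∉ p` on the kernel of a surjection `F → M` from a free module
extends to `F`, then `M` is free at `p`. -/
theorem LocalizedModule.free_of_extension (p : Ideal R) [p.IsPrime] {c : R} (hc : c ∉ p)
    {F M : Type*} [AddCommGroup F] [Module R F] [AddCommGroup M] [Module R M]
    [Module.Finite R F] [Module.Free R F] (π : F →ₗ[R] M) (hπ : Function.Surjective π)
    (f : F →ₗ[R] LinearMap.ker π) (hf : f ∘ₗ (LinearMap.ker π).subtype = c • LinearMap.id) :
    Module.Free (Localization.AtPrime p) (LocalizedModule p.primeCompl M) := by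
  -- This map vanishes on the kernel of π, hence descends to M → F; composed with π it is
  -- multiplication by `c`.
  let g : F →ₗ[R] F := c • LinearMap.id - (LinearMap.ker π).subtype ∘ₗ f
  have hg : LinearMap.ker π ≤ LinearMap.ker g := by
    intro x hx
    have := congrArg Subtype.val (LinearMap.congr_fun hf ⟨x, hx⟩)
    simp only [LinearMap.comp_apply, Submodule.subtype_apply, LinearMap.smul_apply,
      LinearMap.id_apply, Submodule.coe_smul] at this
    simp [g, this]
  refine free_of_comp_eq_smul p hc π
    ((LinearMap.ker π).liftQ g hg ∘ₗ (π.quotKerEquivOfSurjective hπ).symm.toLinearMap) ?_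
  ext y
  obtain ⟨x, rfl⟩ := hπ y
  have : (π.quotKerEquivOfSurjective hπ).symm (π x) = (LinearMap.ker π).mkQ x := by
    rw [LinearEquiv.symm_apply_eq]; rfl
  simp [this, g]

end Splitting

/-! ### Depth in retracts and short exact sequences -/

section Depth

open CategoryTheory Abelian RingTheory.Sequence

namespace LocalCM

variable {R : Type u} [CommRing R] [IsLocalRing R]

variable (R) in
/-- There is a weakly regular sequence of length `d` in the maximal ideal, that is
`d ≤ depth M`. -/
def DepthGE (d : ℕ) (M : Type v) [AddCommGroup M] [Module R M] : Prop :=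
  ∃ rs : List R, rs.length = d ∧ (∀ r ∈ rs, r ∈ maximalIdeal R) ∧ IsWeaklyRegular M rs

theorem DepthGE.congr {d : ℕ} {M : Type*} {N : Type*} [AddCommGroup M] [Module R M]
    [AddCommGroup N] [Module R N] (h : DepthGE R d M) (e : M ≃ₗ[R] N) : DepthGE R d N := by
  obtain ⟨rs, h1, h2, h3⟩ := h
  exact ⟨rs, h1, h2, (e.isWeaklyRegular_congr rs).1 h3⟩

theorem depthGE_of_depth_eq {d : ℕ} {M : Type v} [AddCommGroup M] [Module R M]
    (h : depth R M = d) : DepthGE R d M := by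
  rcases d with _ | d
  · exact ⟨[], rfl, by simp, .nil R M⟩
  · have : (d : ℕ∞) < depth R M := by rw [h]; exact_mod_cast Nat.lt_succ_self d
    obtain ⟨⟨rs, h1, h2⟩, h3⟩ := lt_iSup_iff.1 this
    have h4 : (rs.length : ℕ∞) ≤ depth R M := le_iSup_of_le ⟨rs, h1, h2⟩ le_rfl
    rw [h] at h4
    have h5 : d < rs.length := by exact_mod_cast h3
    have h6 : rs.length ≤ d + 1 := by exact_mod_cast h4
    exact ⟨rs, by omega, h1, h2⟩

theorem DepthGE.pi {d : ℕ} (h : DepthGE R d R) (n : ℕ) : DepthGE R d (Fin n → R) := by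
  obtain ⟨rs, h1, h2, h3⟩ := h
  exact ⟨rs, h1, h2, ((TensorProduct.rid R (Fin n → R)).isWeaklyRegular_congr rs).1
    h3.isWeaklyRegular_lTensor⟩

variable [IsNoetherianRing R]

/-- Each member of a regular sequence lowers the dimension of the support by one. -/
theorem depth_le_ringKrullDim (M : Type v) [AddCommGroup M] [Module R M] [Module.Finite R M]
    [Nontrivial M] : (depth R M : WithBot ℕ∞) ≤ ringKrullDim R := by
  have key : ∀ rs : List R, (∀ r ∈ rs, r ∈ maximalIdeal R) → IsWeaklyRegular M rs →
      (rs.length : WithBot ℕ∞) ≤ ringKrullDim R := by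
    intro rs h1 h2
    have hr := (IsLocalRing.isRegular_iff_isWeaklyRegular_of_subset_maximalIdeal h1).2 h2
    have h3 := Module.supportDim_add_length_eq_supportDim_of_isRegular rs hr
    have : Nontrivial (M ⧸ Ideal.ofList rs • (⊤ : Submodule R M)) :=
      hr.quot_ofList_smul_nontrivial ⊤
    have h4 : 0 ≤ Module.supportDim R (M ⧸ Ideal.ofList rs • (⊤ : Submodule R M)) := by
      rw [← not_lt, WithBot.lt_zero_iff_eq_bot]
      exact Module.supportDim_ne_bot_of_nontrivial R _
    calc (rs.length : WithBot ℕ∞) ≤ Module.supportDim R M := by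
          rw [← h3]; exact le_add_of_nonneg_left h4
      _ ≤ ringKrullDim R := Module.supportDim_le_ringKrullDim R M
  obtain ⟨D, hD⟩ : ∃ D : ℕ∞, (D : WithBot ℕ∞) = ringKrullDim R :=
    WithBot.ne_bot_iff_exists.1 ringKrullDim_ne_bot
  rw [← hD, WithBot.coe_le_coe]
  refine iSup_le fun ⟨rs, h1, h2⟩ => ?_
  have := key rs h1 h2
  rw [← hD] at this
  exact_mod_cast this

/-- Rees' criterion reduces the lemmas below to functoriality and exact sequences of Ext. The zero
module, a possible value of K, is handled by a sequence of zeros. -/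
theorem depthGE_iff_ext {d : ℕ} {M : Type u} [AddCommGroup M] [Module R M] [Module.Finite R M] :
    DepthGE R d M ↔ ∀ i < d, Subsingleton
      (Ext (ModuleCat.of R (R ⧸ maximalIdeal R)) (ModuleCat.of R M) i) := by
  rcases subsingleton_or_nontrivial M with hM | hM
  · refine ⟨fun _ i _ => ?_, fun _ => ⟨List.replicate d 0, by simp, ?_, ?_⟩⟩
    · refine subsingleton_of_forall_eq 0 fun x => ?_
      have hz : 𝟙 (ModuleCat.of R M) = 0 := (ModuleCat.isZero_of_subsingleton _).eq_of_src _ _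
      rw [← x.comp_mk₀_id, hz, Ext.mk₀_zero, Ext.comp_zero]
    · intro r hr
      rw [List.eq_of_mem_replicate hr]
      exact zero_mem _
    · exact (isWeaklyRegular_iff M _).2 fun i hi a b _ => Subsingleton.elim a b
  · have hlt : maximalIdeal R • (⊤ : Submodule R M) < ⊤ := by
      refine lt_top_iff_ne_top.2 fun h => ?_
      have h1 := Submodule.eq_bot_of_le_smul_of_le_jacobson_bot (maximalIdeal R)
        (⊤ : Submodule R M) Module.Finite.fg_top h.ge (maximalIdeal_le_jacobson _)
      exact bot_ne_top h1.symm
    have hs : Module.support R (R ⧸ maximalIdeal R) =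
        PrimeSpectrum.zeroLocus (maximalIdeal R : Set R) := by
      rw [Module.support_eq_zeroLocus, Ideal.annihilator_quotient]
    constructor
    · rintro ⟨rs, h1, h2, h3⟩
      have hr := (IsLocalRing.isRegular_iff_isWeaklyRegular_of_subset_maximalIdeal h2).2 h3
      have := ModuleCat.subsingleton_ext_of_exists_isRegular (maximalIdeal R)
        (ModuleCat.of R (R ⧸ maximalIdeal R)) hs.subset (ModuleCat.of R M) hlt rs h2 hr
      rwa [h1] at this
    · intro h
      obtain ⟨rs, h1, h2, h3⟩ := ModuleCat.exists_isRegular_of_exists_subsingleton_ext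
        (maximalIdeal R) d (ModuleCat.of R M) hlt (ModuleCat.of R (R ⧸ maximalIdeal R)) hs h
      exact ⟨rs, h1, h2, h3.1⟩

variable {A B C : Type u} [AddCommGroup A] [Module R A] [Module.Finite R A]
  [AddCommGroup B] [Module R B] [Module.Finite R B] [AddCommGroup C] [Module R C]
  [Module.Finite R C] {d : ℕ}

theorem DepthGE.of_retract (hB : DepthGE R d B) (s : A →ₗ[R] B) (p : B →ₗ[R] A)
    (h : p ∘ₗ s = LinearMap.id) : DepthGE R d A := by
  rw [depthGE_iff_ext] at hB ⊢
  intro i hi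
  have := hB i hi
  refine subsingleton_of_forall_eq 0 fun x => ?_
  have hsp : ModuleCat.ofHom s ≫ ModuleCat.ofHom p = 𝟙 (ModuleCat.of R A) := by
    rw [← ModuleCat.ofHom_comp, h]; rfl
  rw [← x.comp_mk₀_id, ← hsp, ← Ext.mk₀_comp_mk₀, ← Ext.comp_assoc_of_second_deg_zero,
    Subsingleton.elim (x.comp (Ext.mk₀ (ModuleCat.ofHom s)) (add_zero i)) 0, Ext.zero_comp]

theorem DepthGE.of_exact {i : A →ₗ[R] B} {p : B →ₗ[R] C} (hi : Function.Injective i)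
    (hp : Function.Surjective p) (hip : Function.Exact i p)
    (hA : DepthGE R d A) (hC : DepthGE R d C) : DepthGE R d B := by
  rw [depthGE_iff_ext] at hA hC ⊢
  intro k hk
  have := hA k hk
  have := hC k hk
  have hS := ModuleCat.shortComplex_shortExact
    (ModuleCat.shortComplexOfCompEqZero i p hip.linearMap_comp_eq_zero) hip hi hp
  refine subsingleton_of_forall_eq 0 fun x => ?_
  obtain ⟨y, hy⟩ := Ext.covariant_sequence_exact₂ _ hS x
      (Subsingleton.elim (α := Ext (ModuleCat.of R (R ⧸ maximalIdeal R)) (ModuleCat.of R C) k) _ _)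
  rw [← hy, Subsingleton.elim
    (α := Ext (ModuleCat.of R (R ⧸ maximalIdeal R)) (ModuleCat.of R A) k) y 0, Ext.zero_comp]

theorem DepthGE.of_exact_left {i : A →ₗ[R] B} {p : B →ₗ[R] C} (hi : Function.Injective i)
    (hp : Function.Surjective p) (hip : Function.Exact i p)
    (hB : DepthGE R d B) (hC : DepthGE R d C) : DepthGE R d A := by
  rw [depthGE_iff_ext] at hB hC ⊢
  intro k hk
  have := hB k hk
  have hS := ModuleCat.shortComplex_shortExact
    (ModuleCat.shortComplexOfCompEqZero i p hip.linearMap_comp_eq_zero) hip hi hp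
  refine subsingleton_of_forall_eq 0 fun x => ?_
  -- Degree 0 has no preceding Ext of C; injectivity of `i` is used instead.
  rcases k with _ | k
  · obtain ⟨f, rfl⟩ := Ext.mk₀_bijective _ _ |>.2 x
    have h0 : f ≫ ModuleCat.ofHom i = 0 := by
      rw [← Ext.mk₀_eq_zero_iff]
      exact Subsingleton.elim (α := Ext (ModuleCat.of R (R ⧸ maximalIdeal R))
        (ModuleCat.of R B) 0) _ _
    have : Mono (ModuleCat.ofHom i) := (ModuleCat.mono_iff_injective _).2 hi
    rw [Limits.zero_of_comp_mono _ h0, Ext.mk₀_zero]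
  · have := hC k (by omega)
    obtain ⟨y, hy⟩ := Ext.covariant_sequence_exact₁ _ hS x
      (Subsingleton.elim (α := Ext (ModuleCat.of R (R ⧸ maximalIdeal R)) (ModuleCat.of R B) (k + 1)) _ _)
      rfl
    rw [← hy, Subsingleton.elim
      (α := Ext (ModuleCat.of R (R ⧸ maximalIdeal R)) (ModuleCat.of R C) k) y 0, Ext.zero_comp]

end LocalCM

end Depth

/-! ### Hilbert functions of graded modules -/

section Hilbert

namespace Submodule

variable {R : Type u} [CommRing R] {Y : Type v} [AddCommGroup Y] [Module R Y]

/-- The colength `ℓ(Y ⧸ V)` of a submodule, as a natural number (`0` if infinite). -/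
noncomputable def colength (V : Submodule R Y) : ℕ := (Module.length R (Y ⧸ V)).toNat

theorem length_quotient_eq_add {V U : Submodule R Y} (h : V ≤ U) :
    Module.length R (Y ⧸ V) = Module.length R (Y ⧸ U) + Module.length R (U ⧸ V.comap U.subtype) := by
  have h1 : Function.Exact (V.comap U.subtype |>.mapQ V U.subtype le_rfl) (factor h) := by
    rw [LinearMap.exact_iff]
    ext y
    obtain ⟨y, rfl⟩ := mkQ_surjective _ y
    constructor
    · intro hy
      have hy' : y ∈ U := by simpa using hy
      exact ⟨mkQ _ ⟨y, hy'⟩, rfl⟩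
    · rintro ⟨z, hz⟩
      obtain ⟨z, rfl⟩ := mkQ_surjective _ z
      rw [← hz]
      simp
  rw [add_comm]
  refine Module.length_eq_add_of_exact _ _ ?_ (factor_surjective h) h1
  rw [← LinearMap.ker_eq_bot, ker_mapQ, eq_bot_iff]
  rintro _ ⟨x, hx, rfl⟩
  exact (Submodule.Quotient.mk_eq_zero _).2 hx

theorem length_quotient_ne_top_of_le {V U : Submodule R Y} (h : V ≤ U)
    (hV : Module.length R (Y ⧸ V) ≠ ⊤) : Module.length R (Y ⧸ U) ≠ ⊤ :=
  ne_top_of_le_ne_top hV (by rw [length_quotient_eq_add h]; exact le_self_add)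

theorem colength_anti {V U : Submodule R Y} (h : V ≤ U)
    (hV : Module.length R (Y ⧸ V) ≠ ⊤) : U.colength ≤ V.colength :=
  ENat.toNat_le_toNat (by rw [length_quotient_eq_add h]; exact le_self_add) hV

theorem colength_eq_add {V U : Submodule R Y} (h : V ≤ U)
    (hV : Module.length R (Y ⧸ V) ≠ ⊤) :
    V.colength = U.colength + (Module.length R (U ⧸ V.comap U.subtype)).toNat := by
  have h1 := length_quotient_eq_add h
  rw [h1] at hV
  rw [colength, h1, ENat.toNat_add (WithTop.add_ne_top.1 hV).1 (WithTop.add_ne_top.1 hV).2]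
  rfl

/-- Multiplication by `x` induces `U / (U ∩ x⁻¹ V) ≃ (x U + V) / V`. -/
noncomputable def quotientComapSMulEquiv (U V : Submodule R Y) (x : R) :
    (U ⧸ (U ⊓ V.comap (LinearMap.lsmul R Y x)).comap U.subtype) ≃ₗ[R]
      ((U.map (LinearMap.lsmul R Y x) ⊔ V : Submodule R Y) ⧸
        V.comap (U.map (LinearMap.lsmul R Y x) ⊔ V).subtype) := by
  let W := U.map (LinearMap.lsmul R Y x) ⊔ V
  let f : U →ₗ[R] W := ((LinearMap.lsmul R Y x) ∘ₗ U.subtype).codRestrict W fun u =>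
    le_sup_left (a := U.map (LinearMap.lsmul R Y x)) (Submodule.mem_map_of_mem u.2)
  let g : U →ₗ[R] (W ⧸ V.comap W.subtype) := (V.comap W.subtype).mkQ ∘ₗ f
  have hg : Function.Surjective g := by
    intro w
    obtain ⟨⟨w, hw⟩, rfl⟩ := mkQ_surjective _ w
    obtain ⟨_, ⟨u, hu, rfl⟩, v, hv, rfl⟩ := Submodule.mem_sup.1 hw
    refine ⟨⟨u, hu⟩, ?_⟩
    rw [eq_comm, ← sub_eq_zero]
    change mkQ _ _ - mkQ _ _ = 0
    rw [← map_sub, mkQ_apply, Quotient.mk_eq_zero, Submodule.mem_comap]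
    simpa [f] using hv
  have hk : (U ⊓ V.comap (LinearMap.lsmul R Y x)).comap U.subtype = LinearMap.ker g := by
    ext ⟨u, hu⟩
    change _ ↔ mkQ _ _ = 0
    rw [mkQ_apply, Quotient.mk_eq_zero, Submodule.mem_comap, Submodule.mem_comap]
    simp [f, hu]
  exact (Submodule.quotEquivOfEq _ _ hk).trans (g.quotKerEquivOfSurjective hg)

/-- Both sides are the length of the image of U in Y / V' under multiplication by `x`. -/
theorem colength_map_smul_sup {U V V' : Submodule R Y} {x : R}
    (hV : V ≤ U) (hVx : V ≤ V'.comap (LinearMap.lsmul R Y x))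
    (h : Module.length R (Y ⧸ V) ≠ ⊤) (h' : Module.length R (Y ⧸ V') ≠ ⊤) :
    (V'.colength : ℤ) - (U.map (LinearMap.lsmul R Y x) ⊔ V').colength =
      (U ⊓ V'.comap (LinearMap.lsmul R Y x)).colength - U.colength := by
  rw [colength_eq_add (le_sup_right (a := U.map (LinearMap.lsmul R Y x))) h',
    colength_eq_add (inf_le_left (a := U) (b := V'.comap (LinearMap.lsmul R Y x)))
      (length_quotient_ne_top_of_le (le_inf hV hVx) h), (quotientComapSMulEquiv U V' x).length_eq]
  push_cast
  ring

end Submodule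

open Submodule fwdDiff

variable {R : Type u} [CommRing R] {Y : Type v} [AddCommGroup Y] [Module R Y]

/-- The Hilbert function of a graded module with pieces `U k / V k` that is Noetherian with
respect to the action of the elements of `xs` in degree one is eventually polynomial of degree
less than the length of `xs`. -/
theorem eventually_fwdDiff_iter_colength_sub_eq_zero (xs : List R) (U V : ℕ → Submodule R Y)
    (hVU : ∀ k, V k ≤ U k)
    (hU : ∀ x ∈ xs, ∀ k, U k ≤ (U (k + 1)).comap (LinearMap.lsmul R Y x))
    (hV : ∀ x ∈ xs, ∀ k, V k ≤ (V (k + 1)).comap (LinearMap.lsmul R Y x))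
    (hfin : ∀ k, Module.length R (Y ⧸ V k) ≠ ⊤)
    (hacc : ∀ N : ℕ → ℕ → Submodule R Y, Monotone N → (∀ j, V ≤ N j) → (∀ j, N j ≤ U) →
      (∀ j, ∀ x ∈ xs, ∀ k, N j k ≤ (N j (k + 1)).comap (LinearMap.lsmul R Y x)) →
      ∃ n, ∀ m ≥ n, N n = N m) :
    ∃ k₀, ∀ k ≥ k₀,
      (Δ_[1])^[xs.length] (fun k => ((V k).colength : ℤ) - (U k).colength) k = 0 := by
  induction xs generalizing U V with
  | nil =>
    -- With no operators left, U in degrees below `j` and V above form a chain of graded submodules;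
    -- where it stabilizes, U k = V k.
    have h0 := hacc (fun j k => if k < j then U k else V k) ?_ ?_ ?_ (by simp)
    · obtain ⟨n, hn⟩ := h0
      refine ⟨n, fun k hk => ?_⟩
      have := congrFun (hn (k + 1) (by omega)) k
      simp only [lt_add_one, if_true, if_neg (not_lt.2 hk)] at this
      simp [this]
    · intro a b hab k
      dsimp only
      split_ifs with h1 h2 h2
      · exact le_rfl
      · omega
      · exact hVU k
      · exact le_rfl
    · intro j k
      dsimp only
      split_ifs
      · exact hVU k
      · exact le_rfl
    · intro j k
      dsimp only
      split_ifs
      · exact le_rfl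
      · exact hVU k
  | cons x xs ih =>
    simp only [List.mem_cons, forall_eq_or_imp] at hU hV hacc
    -- Induction is applied to the kernel and the cokernel of `x` on the graded module.
    let X := LinearMap.lsmul R Y x
    obtain ⟨k₁, h₁⟩ := ih (fun k => U k ⊓ (V (k + 1)).comap X) V
      (fun k => le_inf (hVU k) (hV.1 k))
      (fun y hy k u hu => ⟨hU.2 y hy k hu.1, by
        have := hV.2 y hy (k + 1) hu.2
        change y • x • u ∈ V (k + 1 + 1) at this
        change x • y • u ∈ V (k + 1 + 1)
        rwa [smul_comm]⟩)
      hV.2 hfin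
      (fun N hN h1 h2 h3 => hacc N hN h1 (fun j => (h2 j).trans fun k => inf_le_left)
        fun j => ⟨fun k => (h2 j k).trans (inf_le_right.trans (Submodule.comap_mono (h1 j (k + 1)))),
          h3 j⟩)
    obtain ⟨k₂, h₂⟩ := ih (fun k => U (k + 1)) (fun k => (U k).map X ⊔ V (k + 1))
      (fun k => sup_le (map_le_iff_le_comap.2 (hU.1 k)) (hVU (k + 1)))
      (fun y hy k => hU.2 y hy (k + 1))
      (fun y hy k => sup_le (by
          rintro _ ⟨u, hu, rfl⟩
          refine le_sup_left (a := (U (k + 1)).map X) ⟨y • u, hU.2 y hy k hu, ?_⟩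
          simp [X, smul_comm x y])
        ((hV.2 y hy (k + 1)).trans (Submodule.comap_mono le_sup_right)))
      (fun k => length_quotient_ne_top_of_le le_sup_right (hfin (k + 1)))
      (fun N hN h1 h2 h3 => by
        -- The cokernel is indexed from degree 1, so the chain is shifted and padded with V 0.
        have h0 := hacc (fun j k => Nat.casesOn k (V 0) (N j)) ?_ ?_ ?_ ?_
        · obtain ⟨n, hn⟩ := h0
          exact ⟨n, fun m hm => funext fun k => congrFun (hn m hm) (k + 1)⟩
        · rintro a b hab (_ | k)
          · exact le_rfl
          · exact hN hab k
        · rintro j (_ | k)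
          · exact le_rfl
          · exact le_sup_right.trans (h1 j k)
        · rintro j (_ | k)
          · exact hVU 0
          · exact h2 j k
        · refine fun j => ⟨?_, fun y hy => ?_⟩
          · rintro (_ | k)
            · exact (hV.1 0).trans (Submodule.comap_mono (le_sup_right.trans (h1 j 0)))
            · exact (h2 j k).trans (map_le_iff_le_comap.1 (le_sup_left.trans (h1 j (k + 1))))
          · rintro (_ | k)
            · exact (hV.2 y hy 0).trans (Submodule.comap_mono (le_sup_right.trans (h1 j 0)))
            · exact h3 j y hy k)
    refine ⟨max k₁ k₂, fun k hk => ?_⟩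
    -- In the exact sequence from degree k to degree k + 1, the difference of lengths is cokernel
    -- minus kernel.
    have e : Δ_[1] (fun k => ((V k).colength : ℤ) - (U k).colength) =
        (fun k => (((U k).map X ⊔ V (k + 1)).colength : ℤ) - (U (k + 1)).colength) +
        (-1 : ℤ) • (fun k => ((V k).colength : ℤ) - (U k ⊓ (V (k + 1)).comap X).colength) := by
      funext k
      have := colength_map_smul_sup (hVU k) (hV.1 k) (hfin k) (hfin (k + 1))
      simp only [fwdDiff, Pi.add_apply, Pi.smul_apply, smul_eq_mul, X]
      linarith
    rw [List.length_cons, Function.iterate_succ_apply, e, fwdDiff_iter_add,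
      fwdDiff_iter_const_smul, Pi.add_apply, Pi.smul_apply, h₁ k (le_of_max_le_left hk),
      h₂ k (le_of_max_le_right hk)]
    simp

end Hilbert

/-! ### Hilbert–Samuel polynomials and existence of the multiplicity -/

section HilbertSamuel

open fwdDiff Polynomial

theorem fwdDiff_iter_eq_zero_of_forall_ge {H : ℕ → ℤ} {k₀ : ℕ} (h : ∀ k ≥ k₀, H k = 0) (j : ℕ) :
    ∀ k ≥ k₀, (Δ_[1])^[j] H k = 0 := by
  induction j generalizing H with
  | zero => exact h
  | succ j ih =>
    rw [Function.iterate_succ]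
    exact ih fun k hk => by simp [fwdDiff, h k hk, h (k + 1) (by omega)]

/-- Newton's interpolation formula at `k₀`, in which only the differences of order at most `t`
survive. -/
theorem exists_polynomial_of_fwdDiff_iter_eq_zero {H : ℕ → ℤ} {t k₀ : ℕ}
    (h : ∀ k ≥ k₀, (Δ_[1])^[t + 1] H k = 0) :
    ∃ p : ℝ[X], p.natDegree ≤ t ∧ ∀ k ≥ k₀, (H k : ℝ) = p.eval (k : ℝ) := by
  have hz : ∀ j ≥ t + 1, (Δ_[1])^[j] H k₀ = 0 := by
    intro j hj
    obtain ⟨i, rfl⟩ := Nat.exists_eq_add_of_le' hj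
    rw [Function.iterate_add_apply]
    exact fwdDiff_iter_eq_zero_of_forall_ge h i k₀ le_rfl
  refine ⟨∑ j ∈ Finset.range (t + 1), C ((((Δ_[1])^[j] H k₀ : ℤ) : ℝ) / j.factorial) *
    (descPochhammer ℝ j).comp (X - C (k₀ : ℝ)), ?_, fun k hk => ?_⟩
  · refine natDegree_sum_le_of_forall_le _ _ fun j hj => ?_
    refine (natDegree_C_mul_le _ _).trans ?_
    rw [natDegree_comp, natDegree_X_sub_C, mul_one, descPochhammer_natDegree]
    exact Nat.lt_succ_iff.1 (Finset.mem_range.1 hj)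
  · obtain ⟨n, rfl⟩ := Nat.exists_eq_add_of_le hk
    have h1 := shift_eq_sum_fwdDiff_iter 1 H n k₀
    have h2 : ∑ k ∈ Finset.range (n + 1), n.choose k • (Δ_[1])^[k] H k₀ =
        ∑ k ∈ Finset.range (t + 1), n.choose k • (Δ_[1])^[k] H k₀ := by
      rcases le_total n t with hnt | hnt
      · refine Finset.sum_subset (Finset.range_mono (by omega)) fun j _ hj => ?_
        rw [Nat.choose_eq_zero_of_lt (by simpa using hj), zero_smul]
      · refine (Finset.sum_subset (Finset.range_mono (by omega)) fun j _ hj => ?_).symm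
        rw [hz j (by simpa using hj), smul_zero]
    rw [h2, smul_eq_mul, mul_one] at h1
    rw [h1, eval_finsetSum]
    push_cast
    refine Finset.sum_congr rfl fun j _ => ?_
    simp only [eval_mul, eval_C, eval_comp, eval_sub, eval_X, add_sub_cancel_left,
      nsmul_eq_mul]
    push_cast [Nat.cast_choose_eq_descPochhammer_div (K := ℝ)]
    ring

theorem Submodule.ideal_span_smul_le {R : Type u} [CommRing R] {Y : Type v}
    [AddCommGroup Y] [Module R Y] {xs : List R} {N N' : Submodule R Y}
    (h : ∀ x ∈ xs, N ≤ N'.comap (LinearMap.lsmul R Y x)) :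
    Ideal.span {x | x ∈ xs} • N ≤ N' := by
  rw [Submodule.smul_le]
  intro r hr n hn
  refine Submodule.span_induction (p := fun r _ => r • n ∈ N') (fun x hx => h x hx hn) (by simp)
    (fun a b _ _ ha hb => by rw [add_smul]; exact add_mem ha hb)
    (fun a b _ hb => by rw [smul_assoc]; exact N'.smul_mem a hb) hr

variable {R : Type u} [CommRing R] [IsNoetherianRing R] {Y : Type v} [AddCommGroup Y] [Module R Y]
  [Module.Finite R Y]

/-- The associated graded module of `Y` satisfies the ascending chain condition on graded
submodules. -/
theorem Ideal.exists_forall_eq_of_monotone_graded (I : Ideal R) (N : ℕ → ℕ → Submodule R Y)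
    (hN : Monotone N) (h1 : ∀ j k, I ^ (k + 1) • ⊤ ≤ N j k) (h2 : ∀ j k, N j k ≤ I ^ k • ⊤)
    (h3 : ∀ j k, I • N j k ≤ N j (k + 1)) : ∃ n, ∀ m ≥ n, N n = N m := by
  -- The chain becomes one of submodules of the Rees module of Y, which is Noetherian over the Rees
  -- algebra.
  let F : ℕ → I.Filtration Y := fun j =>
    { N := N j
      mono := fun k => (h2 j (k + 1)).trans (h1 j k)
      smul_le := h3 j }
  have hst := Ideal.stableFiltration_stable I (⊤ : Submodule R Y)
  have hfg := ((I.stableFiltration (⊤ : Submodule R Y)).submodule_fg_iff_stable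
    (fun i => IsNoetherian.noetherian _)).2 hst
  have := isNoetherian_of_fg_of_noetherian _ hfg
  let T := (I.stableFiltration (⊤ : Submodule R Y)).submodule
  let G : ℕ →o Submodule (reesAlgebra I) T :=
    ⟨fun j => (F j).submodule.comap T.subtype, fun a b hab => Submodule.comap_mono
      fun f hf i => hN hab i (hf i)⟩
  obtain ⟨n, hn⟩ := monotone_stabilizes_iff_noetherian.2 this G
  refine ⟨n, fun m hm => le_antisymm (hN hm) fun k y hy => ?_⟩
  have hmem : ∀ j, y ∈ N j k → PolynomialModule.single R k y ∈ (F j).submodule := by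
    intro j hj i
    rw [PolynomialModule.coeff_single, Finsupp.single_apply]
    split_ifs with h
    · subst h; exact hj
    · exact zero_mem _
  have hT : PolynomialModule.single R k y ∈ T := fun i => h2 m i (hmem m hy i)
  have h4 : (⟨_, hT⟩ : T) ∈ G n := by
    rw [hn m hm]
    exact hmem m hy
  have h5 := (show PolynomialModule.single R k y ∈ (F n).submodule from h4) k
  rwa [PolynomialModule.coeff_single, Finsupp.single_eq_same] at h5

/-- The first difference of the colength is the Hilbert function of the associated graded module;
this extra difference is why the degree may equal `xs.length`. -/
theorem Ideal.exists_polynomial_colength [IsLocalRing R] (Y : Type v) [AddCommGroup Y] [Module R Y]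
    [Module.Finite R Y] (xs : List R) {s : ℕ}
    (hs : maximalIdeal R ^ s ≤ Ideal.span {x | x ∈ xs}) :
    ∃ p : ℝ[X], p.natDegree ≤ xs.length ∧ ∀ᶠ k : ℕ in atTop,
      ((Ideal.span {x | x ∈ xs} ^ k • (⊤ : Submodule R Y)).colength : ℝ) = p.eval (k : ℝ) := by
  set I := Ideal.span {x | x ∈ xs} with hI
  have hfin : ∀ k, Module.length R (Y ⧸ (I ^ k • (⊤ : Submodule R Y))) ≠ ⊤ := fun k =>
    Submodule.length_quotient_ne_top_of_le
      (Submodule.smul_mono_left (by rw [pow_mul]; exact Ideal.pow_right_mono hs k))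
      (Module.length_quotient_pow_smul_ne_top Y (s * k))
  have hx : ∀ x ∈ xs, ∀ k, I ^ k • (⊤ : Submodule R Y) ≤
      (I ^ (k + 1) • (⊤ : Submodule R Y)).comap (LinearMap.lsmul R Y x) := by
    intro x hx k y hy
    have : x • y ∈ I • (I ^ k • (⊤ : Submodule R Y)) :=
      Submodule.smul_mem_smul (Ideal.subset_span hx) hy
    rwa [← Submodule.smul_assoc, smul_eq_mul, ← pow_succ'] at this
  obtain ⟨k₀, hk₀⟩ := eventually_fwdDiff_iter_colength_sub_eq_zero xs
    (fun k => I ^ k • (⊤ : Submodule R Y)) (fun k => I ^ (k + 1) • (⊤ : Submodule R Y))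
    (fun k => Submodule.smul_mono_left (Ideal.pow_le_pow_right k.le_succ)) hx
    (fun x h k => hx x h (k + 1)) (fun k => hfin (k + 1))
    (fun N hN h1 h2 h3 => Ideal.exists_forall_eq_of_monotone_graded I N hN h1 h2
      fun j k => Submodule.ideal_span_smul_le fun x hx => h3 j x hx k)
  obtain ⟨p, hp, hpk⟩ := exists_polynomial_of_fwdDiff_iter_eq_zero
    (H := fun k => ((I ^ k • (⊤ : Submodule R Y)).colength : ℤ)) (t := xs.length) (k₀ := k₀)
    (fun k hk => hk₀ k hk)
  exact ⟨p, hp, eventually_atTop.2 ⟨k₀, fun k hk => by exact_mod_cast hpk k hk⟩⟩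

theorem Polynomial.natDegree_le_of_eventually_le {p q : ℝ[X]} {d : ℕ} (hq : q.natDegree ≤ d)
    (h0 : ∀ᶠ k : ℕ in atTop, 0 ≤ p.eval (k : ℝ))
    (h : ∀ᶠ k : ℕ in atTop, p.eval (k : ℝ) ≤ q.eval (k : ℝ)) : p.natDegree ≤ d := by
  by_contra! hd
  have hX : ((X : ℝ[X]) ^ d).degree = d := degree_X_pow d
  have h1 : Tendsto (fun k : ℕ => |p.eval (k : ℝ) / ((X : ℝ[X]) ^ d).eval (k : ℝ)|) atTop atTop :=
    (abs_div_tendsto_atTop_atTop_of_degree_gt p (X ^ d)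
      (by rw [hX]; exact (coe_lt_degree.2 hd)) (by simp)).comp
      tendsto_natCast_atTop_atTop
  have h2 := (isBigO_atTop_of_degree_le q (X ^ d)
    (by rw [hX]; exact degree_le_of_natDegree_le hq)).comp_tendsto
      (tendsto_natCast_atTop_atTop (R := ℝ))
  obtain ⟨c, hc⟩ := h2.bound
  obtain ⟨k, h3, h4, h5, h6, h7⟩ := ((h1.eventually_gt_atTop c).and (h0.and (h.and
    (hc.and (eventually_gt_atTop 0))))).exists
  simp only [Function.comp_apply, eval_pow, eval_X, norm_pow, Real.norm_eq_abs,
    Nat.abs_cast] at h3 h6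
  have h8 : (0 : ℝ) < (k : ℝ) ^ d := by positivity
  rw [abs_of_nonneg (by positivity), lt_div_iff₀ h8] at h3
  linarith [le_abs_self (q.eval (k : ℝ))]

theorem Polynomial.exists_tendsto_div_pow {p : ℝ[X]} {d : ℕ} (hp : p.natDegree ≤ d) :
    ∃ e : ℝ, Tendsto (fun k : ℕ => p.eval (k : ℝ) / (k : ℝ) ^ d) atTop (𝓝 e) := by
  have hX : ((X : ℝ[X]) ^ d).degree = d := degree_X_pow d
  rcases (degree_le_of_natDegree_le hp).lt_or_eq with h | h
  · refine ⟨0, ?_⟩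
    have := (div_tendsto_atTop_zero_of_degree_lt p (X ^ d) (hX ▸ h)).comp
      (tendsto_natCast_atTop_atTop (R := ℝ))
    simpa [Function.comp_def] using this
  · have := (div_tendsto_atTop_leadingCoeff_div_of_degree_eq p (X ^ d) (h.trans hX.symm)).comp
      (tendsto_natCast_atTop_atTop (R := ℝ))
    exact ⟨_, by simpa [Function.comp_def] using this⟩

namespace LocalCM

variable [IsLocalRing R]

variable (R) in
-- A system of parameters: 𝔪 is minimal over an ideal generated by ht 𝔪 elements, hence is its
-- radical.
theorem exists_parameters : ∃ xs : List R, xs.length = dim R ∧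
    Ideal.span {x | x ∈ xs} ≤ maximalIdeal R ∧
    ∃ s, maximalIdeal R ^ s ≤ Ideal.span {x | x ∈ xs} := by
  obtain ⟨S, hS, hc⟩ := (maximalIdeal R).exists_finset_card_eq_height_of_isNoetherianRing
  have hset : {x | x ∈ S.toList} = (S : Set R) := by ext; simp
  refine ⟨S.toList, ?_, ?_, ?_⟩
  · rw [Finset.length_toList, dim, ← maximalIdeal_height_eq_ringKrullDim, ← hc]
    rfl
  · rw [hset]; exact hS.le
  · rw [hset]
    refine Ideal.exists_pow_le_of_le_radical_of_fg ?_ (IsNoetherian.noetherian _)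
    rw [Ideal.radical_eq_sInf]
    refine le_sInf fun J ⟨hJ, hp⟩ => ?_
    exact hS.2 ⟨hp, hJ⟩ (le_maximalIdeal hp.ne_top)

/-- Generators of 𝔪 yield a polynomial, but possibly too weak a degree bound. Comparison with the
powers of a parameter ideal inside 𝔪 brings the degree down to dim R. -/
theorem exists_tendsto_hilbertSamuel (Y : Type v) [AddCommGroup Y] [Module R Y]
    [Module.Finite R Y] : ∃ e : ℝ, Tendsto (fun k : ℕ =>
      ((dim R).factorial : ℝ) * (hilbertSamuel R Y k : ℝ) / (k : ℝ) ^ dim R) atTop (𝓝 e) := by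
  obtain ⟨xs, hlen, hle, s, hs⟩ := exists_parameters R
  obtain ⟨q, hq, hqk⟩ := Ideal.exists_polynomial_colength Y xs hs
  obtain ⟨S, hS⟩ := IsNoetherian.noetherian (maximalIdeal R)
  have hset : Ideal.span {x | x ∈ S.toList} = maximalIdeal R := by rw [← hS]; congr 1; ext; simp
  obtain ⟨p, -, hpk⟩ := Ideal.exists_polynomial_colength Y S.toList (s := 1)
    (by rw [hset, pow_one])
  rw [hset] at hpk
  have hpd : p.natDegree ≤ dim R := by
    refine natDegree_le_of_eventually_le (hq.trans_eq hlen) ?_ ?_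
    · filter_upwards [hpk] with k hk
      rw [← hk]; positivity
    · filter_upwards [hpk, hqk] with k h1 h2
      rw [← h1, ← h2, Nat.cast_le]
      refine Submodule.colength_anti (Submodule.smul_mono_left (Ideal.pow_right_mono hle k)) ?_
      refine Submodule.length_quotient_ne_top_of_le (Submodule.smul_mono_left ?_)
        (Module.length_quotient_pow_smul_ne_top Y (s * k))
      rw [pow_mul]; exact Ideal.pow_right_mono hs k
  obtain ⟨e, he⟩ := exists_tendsto_div_pow hpd
  refine ⟨(dim R).factorial * e, (he.const_mul _).congr' ?_⟩
  filter_upwards [hpk] with k hk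
  rw [← hk, mul_div_assoc]
  rfl

theorem tendsto_mult (Y : Type v) [AddCommGroup Y] [Module R Y]
    [Module.Finite R Y] : Tendsto (fun k : ℕ =>
      ((dim R).factorial : ℝ) * (hilbertSamuel R Y k : ℝ) / (k : ℝ) ^ dim R) atTop
      (𝓝 (mult R Y)) :=
  tendsto_nhds_limUnder (exists_tendsto_hilbertSamuel Y)

/-- The shift is invisible in the limit because ((k + c)/k)^d → 1. -/
theorem mult_le_mul_mult {Y : Type v} [AddCommGroup Y] [Module R Y] [Module.Finite R Y]
    {Z : Type*} [AddCommGroup Z] [Module R Z] [Module.Finite R Z] {n c : ℕ}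
    (h : ∀ k, hilbertSamuel R Y k ≤ n * hilbertSamuel R Z (k + c)) :
    mult R Y ≤ n * mult R Z := by
  have h1 := (tendsto_mult (R := R) Z).comp (tendsto_add_atTop_nat c)
  have h2 : Tendsto (fun k : ℕ => (((k + c : ℕ) : ℝ) / k) ^ dim R) atTop (𝓝 1) := by
    have h3 : Tendsto (fun k : ℕ => 1 + (c : ℝ) / k) atTop (𝓝 (1 + 0)) :=
      tendsto_const_nhds.add (tendsto_const_div_atTop_nhds_zero_nat (c : ℝ))
    have h4 : Tendsto (fun k : ℕ => (1 + (c : ℝ) / k) ^ dim R) atTop (𝓝 1) := by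
      simpa using h3.pow (dim R)
    refine h4.congr' ?_
    filter_upwards [eventually_gt_atTop 0] with k hk
    have : (k : ℝ) ≠ 0 := by positivity
    push_cast
    rw [add_div, div_self this]
  have h3 := (h2.mul h1).const_mul (n : ℝ)
  rw [one_mul] at h3
  refine le_of_tendsto_of_tendsto (tendsto_mult Y) h3 ?_
  filter_upwards [eventually_gt_atTop 0] with k hk
  have hk' : (0 : ℝ) < k := by positivity
  have hkc : (0 : ℝ) < ((k + c : ℕ) : ℝ) := by positivity
  have h5 : (hilbertSamuel R Y k : ℝ) ≤ n * hilbertSamuel R Z (k + c) := by exact_mod_cast h k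
  have h6 : (n : ℝ) * ((((k + c : ℕ) : ℝ) / k) ^ dim R * ((dim R).factorial *
      (hilbertSamuel R Z (k + c) : ℝ) / ((k + c : ℕ) : ℝ) ^ dim R)) =
      (dim R).factorial * (n * hilbertSamuel R Z (k + c)) / (k : ℝ) ^ dim R := by
    rw [div_pow]
    field_simp
  simp only [Function.comp_apply]
  rw [h6]
  gcongr

end LocalCM

end HilbertSamuel

namespace LocalCM

/-! ### Hilbert–Samuel functions in exact sequences -/

section HilbertBounds

variable {R : Type u} [CommRing R]

/-- The left term is A modulo the preimage of I B, which may exceed I A; bounding this preimage from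
either side gives the inequalities below. -/
theorem length_quotient_smul_top_eq_add {A B C : Type*} [AddCommGroup A] [AddCommGroup B]
    [AddCommGroup C] [Module R A] [Module R B] [Module R C] (I : Ideal R) {i : A →ₗ[R] B}
    {p : B →ₗ[R] C} (hp : Function.Surjective p) (hip : Function.Exact i p) :
    Module.length R (B ⧸ (I • (⊤ : Submodule R B))) =
      Module.length R (A ⧸ (I • (⊤ : Submodule R B)).comap i) +
        Module.length R (C ⧸ (I • (⊤ : Submodule R C))) := by
  have hmap : (I • (⊤ : Submodule R B)).map p = I • ⊤ := by
    rw [Submodule.map_smul'', Submodule.map_top, LinearMap.range_eq_top.2 hp]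
  refine Module.length_eq_add_of_exact (Submodule.mapQ _ _ i le_rfl)
    (Submodule.mapQ _ _ p (Submodule.map_le_iff_le_comap.1 hmap.le)) ?_ ?_ ?_
  · rw [← LinearMap.ker_eq_bot, Submodule.ker_mapQ, eq_bot_iff]
    rintro _ ⟨x, hx, rfl⟩
    exact (Submodule.Quotient.mk_eq_zero _).2 hx
  · intro c
    obtain ⟨c, rfl⟩ := Submodule.mkQ_surjective _ c
    obtain ⟨b, rfl⟩ := hp c
    exact ⟨Submodule.mkQ _ b, rfl⟩
  · intro b
    obtain ⟨b, rfl⟩ := Submodule.mkQ_surjective _ b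
    constructor
    · intro hb
      have hb' : p b ∈ I • (⊤ : Submodule R C) := (Submodule.Quotient.mk_eq_zero _).1 hb
      rw [← hmap] at hb'
      obtain ⟨b', hb', h⟩ := hb'
      obtain ⟨a, ha⟩ := (hip (b - b')).1 (by rw [map_sub, h, sub_self])
      refine ⟨Submodule.mkQ _ a, ?_⟩
      change Submodule.mkQ _ (i a) = Submodule.mkQ _ b
      rw [ha, map_sub, sub_eq_self]
      exact (Submodule.Quotient.mk_eq_zero _).2 hb'
    · rintro ⟨a, ha⟩
      obtain ⟨a, rfl⟩ := Submodule.mkQ_surjective _ a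
      rw [← ha]
      change Submodule.mkQ _ (p (i a)) = 0
      rw [hip.apply_apply_eq_zero, map_zero]

variable [IsLocalRing R] [IsNoetherianRing R]

theorem length_eq_hilbertSamuel (Y : Type*) [AddCommGroup Y] [Module R Y] [Module.Finite R Y]
    (k : ℕ) : Module.length R (Y ⧸ (maximalIdeal R ^ k • (⊤ : Submodule R Y))) =
      hilbertSamuel R Y k :=
  (ENat.natCast_toNat (Module.length_quotient_pow_smul_ne_top Y k)).symm

variable {A B C : Type*} [AddCommGroup A] [AddCommGroup B] [AddCommGroup C] [Module R A]
  [Module R B] [Module R C] [Module.Finite R A] [Module.Finite R B] [Module.Finite R C]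

theorem hilbertSamuel_mono : Monotone (hilbertSamuel R A) := fun _ l h =>
  Submodule.colength_anti (Submodule.smul_mono_left (Ideal.pow_le_pow_right h))
    (Module.length_quotient_pow_smul_ne_top A l)

theorem hilbertSamuel_le_add {i : A →ₗ[R] B} {p : B →ₗ[R] C} (hp : Function.Surjective p)
    (hip : Function.Exact i p) (k : ℕ) :
    hilbertSamuel R B k ≤ hilbertSamuel R A k + hilbertSamuel R C k := by
  have h := length_quotient_smul_top_eq_add (maximalIdeal R ^ k) hp hip
  have h1 : maximalIdeal R ^ k • (⊤ : Submodule R A) ≤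
      (maximalIdeal R ^ k • (⊤ : Submodule R B)).comap i := by
    rw [← Submodule.map_le_iff_le_comap, Submodule.map_smul'']
    exact Submodule.smul_mono le_rfl le_top
  have h2 := Module.length_le_of_surjective _ (Submodule.factor_surjective h1)
  rw [length_eq_hilbertSamuel] at h h2
  rw [length_eq_hilbertSamuel] at h
  have h3 := h.le.trans (add_le_add_left h2 _)
  exact_mod_cast h3

theorem add_le_hilbertSamuel {i : A →ₗ[R] B} {p : B →ₗ[R] C} (hp : Function.Surjective p)
    (hip : Function.Exact i p) {k l : ℕ}
    (hkl : (maximalIdeal R ^ k • (⊤ : Submodule R B)).comap i ≤ maximalIdeal R ^ l • ⊤) :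
    hilbertSamuel R A l + hilbertSamuel R C k ≤ hilbertSamuel R B k := by
  have h := length_quotient_smul_top_eq_add (maximalIdeal R ^ k) hp hip
  have h2 := Module.length_le_of_surjective _ (Submodule.factor_surjective hkl)
  rw [length_eq_hilbertSamuel] at h h2
  rw [length_eq_hilbertSamuel] at h
  have h3 := (add_le_add_left h2 _).trans h.ge
  exact_mod_cast h3

theorem hilbertSamuel_add_le_of_linearEquiv (e : B ≃ₗ[R] A × C) (k : ℕ) :
    hilbertSamuel R A k + hilbertSamuel R C k ≤ hilbertSamuel R B k := by
  refine add_le_hilbertSamuel (i := e.symm.toLinearMap ∘ₗ LinearMap.inl R A C)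
    (p := LinearMap.snd R A C ∘ₗ e.toLinearMap) (fun c => ⟨e.symm (0, c), by simp⟩) ?_ ?_
  · intro b
    constructor
    · intro hb
      refine ⟨(e b).1, ?_⟩
      change e.symm ((e b).1, 0) = b
      rw [LinearEquiv.symm_apply_eq]
      exact Prod.ext rfl hb.symm
    · rintro ⟨a, rfl⟩
      simp
  · intro a ha
    have h1 : (maximalIdeal R ^ k • (⊤ : Submodule R B)).map
        (LinearMap.fst R A C ∘ₗ e.toLinearMap) ≤ maximalIdeal R ^ k • ⊤ := by
      rw [Submodule.map_smul'']
      exact Submodule.smul_mono le_rfl le_top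
    simpa using h1 ⟨_, ha, rfl⟩

/-- Nakayama's lemma; it makes the value at 1 a strictly decreasing measure for splitting off
summands. -/
theorem hilbertSamuel_pos [Nontrivial A] : 0 < hilbertSamuel R A 1 := by
  rw [Nat.pos_iff_ne_zero]
  intro h
  have h1 := length_eq_hilbertSamuel (R := R) A 1
  rw [h, Nat.cast_zero, Module.length_eq_zero_iff, Submodule.Quotient.subsingleton_iff,
    pow_one] at h1
  have h2 := Submodule.eq_bot_of_le_smul_of_le_jacobson_bot (maximalIdeal R)
    (⊤ : Submodule R A) Module.Finite.fg_top h1.ge (maximalIdeal_le_jacobson _)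
  exact bot_ne_top h2.symm

variable (R) in
theorem hilbertSamuel_pi_le (n k : ℕ) :
    hilbertSamuel R (Fin n → R) k ≤ n * hilbertSamuel R R k := by
  let I := maximalIdeal R ^ k
  let f : (Fin n → R) →ₗ[R] (Fin n → R ⧸ (I • (⊤ : Submodule R R))) :=
    (I • (⊤ : Submodule R R)).mkQ.compLeft (Fin n)
  have hf : LinearMap.ker f ≤ I • (⊤ : Submodule R (Fin n → R)) := fun w hw =>
    Submodule.mem_ideal_smul_top_pi I w fun i =>
      (Submodule.Quotient.mk_eq_zero _).1 (congrFun hw i)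
  have h1 := (Module.length_le_of_surjective _ (Submodule.factor_surjective hf)).trans
    (Module.length_le_of_injective ((LinearMap.ker f).liftQ f le_rfl)
      (LinearMap.ker_eq_bot.1 (Submodule.ker_liftQ_eq_bot _ _ _ le_rfl)))
  rw [Module.length_pi, ENat.card_eq_coe_fintype_card, Fintype.card_fin] at h1
  simp only [I] at h1
  rw [length_eq_hilbertSamuel, length_eq_hilbertSamuel] at h1
  exact_mod_cast h1

/-- All extensions of `F ⧸ K` by `K ⊆ F = R ^ n` have Hilbert-Samuel function bounded by a
shift of the one of `R ^ n`. -/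
theorem exists_hilbertSamuel_le {n : ℕ} (K : Submodule R (Fin n → R)) :
    ∃ c : ℕ, ∀ k, hilbertSamuel R K k + hilbertSamuel R ((Fin n → R) ⧸ K) k ≤
      n * hilbertSamuel R R (k + c) := by
  -- The shift `c` is the Artin–Rees constant of K in R^n.
  obtain ⟨c, hc⟩ := Ideal.exists_pow_inf_eq_pow_smul (maximalIdeal R) K
  refine ⟨c, fun k => ?_⟩
  have h1 : (maximalIdeal R ^ (k + c) • (⊤ : Submodule R (Fin n → R))).comap K.subtype ≤
      maximalIdeal R ^ k • ⊤ := by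
    rw [← Submodule.map_le_map_iff_of_injective K.injective_subtype, Submodule.map_comap_subtype,
      Submodule.map_smul'', Submodule.map_top, Submodule.range_subtype, inf_comm,
      hc (k + c) (Nat.le_add_left _ _), Nat.add_sub_cancel]
    exact Submodule.smul_mono le_rfl inf_le_right
  calc _ ≤ hilbertSamuel R K k + hilbertSamuel R ((Fin n → R) ⧸ K) (k + c) :=
        Nat.add_le_add_left (hilbertSamuel_mono (Nat.le_add_right _ _)) _
    _ ≤ hilbertSamuel R (Fin n → R) (k + c) :=
        add_le_hilbertSamuel K.mkQ_surjective (LinearMap.exact_subtype_mkQ K) h1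
    _ ≤ _ := hilbertSamuel_pi_le R n _

end HilbertBounds

/-! ### Bounded decompositions into indecomposables -/

section Decomposition

variable {R : Type u} [CommRing R] [IsLocalRing R] [IsNoetherianRing R]

theorem exists_linearEquiv_prod_indecomposable (X : ModuleCat.{u} R) [Module.Finite R X]
    [Nontrivial X] : ∃ A B : ModuleCat.{u} R, Module.Finite R A ∧ Module.Finite R B ∧
      IsIndecomposable R A ∧ Nonempty (X ≃ₗ[R] A × B) := by
  induction h : hilbertSamuel R X 1 using Nat.strong_induction_on generalizing X with
  | _ m ih =>
    by_cases hX : IsIndecomposable R X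
    · exact ⟨X, ModuleCat.of R PUnit, inferInstance, inferInstanceAs (Module.Finite R PUnit.{u + 1}), hX,
        ⟨LinearEquiv.prodUnique.symm⟩⟩
    · rw [IsIndecomposable] at hX
      push Not at hX
      obtain ⟨p, q, hpq, hp, hq⟩ := hX inferInstance
      let e := (Submodule.prodEquivOfIsCompl p q hpq).symm
      have : Nontrivial p := Submodule.nontrivial_iff_ne_bot.2 hp
      have : Nontrivial q := Submodule.nontrivial_iff_ne_bot.2 hq
      have h1 := hilbertSamuel_add_le_of_linearEquiv e 1
      have h2 := hilbertSamuel_pos (R := R) (A := q)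
      obtain ⟨A, B, hA, hB, hI, ⟨f⟩⟩ := ih (hilbertSamuel R p 1) (by omega)
        (ModuleCat.of R p) rfl
      exact ⟨A, ModuleCat.of R (B × q), hA, inferInstanceAs (Module.Finite R (B × q)), hI,
        ⟨e.trans ((f.prodCongr (LinearEquiv.refl R q)).trans (LinearEquiv.prodAssoc R A B q))⟩⟩

/-- The direct sum of representatives of a list of isomorphism classes of modules. -/
noncomputable def directSumOfClasses
    (l : List (Quotient (CategoryTheory.isIsomorphicSetoid (ModuleCat.{u} R)))) :
    ModuleCat.{u} R :=
  l.foldr (fun s X => ModuleCat.of R (s.out × X)) (ModuleCat.of R PUnit)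

/-- Only existence of a decomposition is needed, not uniqueness: for finite S, bounded lists give
finitely many isomorphism classes. -/
theorem exists_linearEquiv_directSumOfClasses
    {S : Set (Quotient (CategoryTheory.isIsomorphicSetoid (ModuleCat.{u} R)))}
    (Q : ModuleCat.{u} R → Prop)
    (hQ : ∀ X A B : ModuleCat.{u} R, (X ≃ₗ[R] A × B) → Module.Finite R X → Module.Finite R A →
      Module.Finite R B → Q X → Q A ∧ Q B)
    (hS : ∀ A : ModuleCat.{u} R, Module.Finite R A → IsIndecomposable R A → Q A →
      Quotient.mk _ A ∈ S)
    (X : ModuleCat.{u} R) [Module.Finite R X] (hX : Q X) :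
    ∃ l : List S, l.length ≤ hilbertSamuel R X 1 ∧
      Nonempty (X ≃ₗ[R] directSumOfClasses (l.map Subtype.val)) := by
  induction h : hilbertSamuel R X 1 using Nat.strong_induction_on generalizing X with
  | _ m ih =>
    rcases subsingleton_or_nontrivial X with hX' | hX'
    · refine ⟨[], Nat.zero_le _, ⟨?_⟩⟩
      have : Subsingleton (directSumOfClasses (R := R) (([] : List S).map Subtype.val)) :=
        inferInstanceAs (Subsingleton PUnit)
      exact LinearEquiv.ofSubsingleton _ _
    · obtain ⟨A, B, hA, hB, hI, ⟨e⟩⟩ := exists_linearEquiv_prod_indecomposable X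
      obtain ⟨hQA, hQB⟩ := hQ X A B e inferInstance hA hB hX
      have h1 := hilbertSamuel_add_le_of_linearEquiv e 1
      have := hI.1
      have h2 := hilbertSamuel_pos (R := R) (A := A)
      obtain ⟨l, hl, ⟨f⟩⟩ := ih (hilbertSamuel R B 1) (by omega) B hQB rfl
      have hAS := hS A hA hI hQA
      have hiso := Quotient.exact (Quotient.out_eq (Quotient.mk
        (CategoryTheory.isIsomorphicSetoid (ModuleCat.{u} R)) A))
      obtain ⟨g⟩ := hiso
      refine ⟨⟨_, hAS⟩ :: l, by rw [List.length_cons]; omega, ⟨?_⟩⟩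
      exact e.trans (g.toLinearEquiv.symm.prodCongr f)

end Decomposition

/-! ### Pigeonhole on the pushouts and conclusion -/

section Main

variable {R : Type u} [CommRing R] [IsLocalRing R] [IsNoetherianRing R]

theorem isMCM_of_depthGE {d : ℕ} (hd : ringKrullDim R = d) {Y : Type v} [AddCommGroup Y]
    [Module R Y] [Module.Finite R Y] [Nontrivial Y] (h : DepthGE R d Y) : IsMCM R Y := by
  refine ⟨inferInstance, le_antisymm (depth_le_ringKrullDim Y) ?_⟩
  obtain ⟨rs, h1, h2, h3⟩ := h
  have h4 : (rs.length : ℕ∞) ≤ depth R Y := le_iSup_of_le ⟨rs, h2, h3⟩ le_rfl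
  rw [h1] at h4
  rw [hd]
  exact_mod_cast h4

/-- If the extensions of `F ⧸ K` by `K` given by the powers of `c` fall into finitely many
isomorphism classes, then the multiplication by some power of `c` on `K` extends to `F`. -/
theorem exists_extension_pow_smul {F : Type u} [AddCommGroup F] [Module R F] [Module.Finite R F]
    [Module.Projective R F] (K : Submodule R F) {c : R} (hc : c ∈ maximalIdeal R) {T : Type*}
    [Finite T] (t : ℕ → T)
    (ht : ∀ i j, t i = t j → Nonempty (SMulPushout K (c ^ i) ≃ₗ[R] SMulPushout K (c ^ j))) :
    ∃ j : ℕ, ∃ f : F →ₗ[R] K, f ∘ₗ K.subtype = (c ^ j) • LinearMap.id := by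
  obtain ⟨y, hy⟩ := Finite.exists_infinite_fiber t
  rw [Set.infinite_coe_iff] at hy
  obtain ⟨j, hj⟩ := hy.nonempty
  refine ⟨j, K.exists_extension_of_forall_modulo _ fun s => ?_⟩
  -- The fiber is infinite, so `i` can exceed `s`, and then `c ^ i` kills K / 𝔪^s K; `j` stays
  -- fixed.
  obtain ⟨i, hi, hsi⟩ := hy.exists_gt s
  obtain ⟨e⟩ := ht i j (hi.trans hj.symm)
  let N := maximalIdeal R ^ s • (⊤ : Submodule R K)
  obtain ⟨f, hf⟩ := SMulPushout.extension_of_linearEquiv K (c ^ i) (c' := c ^ j) (L := K ⧸ N)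
    (Module.length_quotient_pow_smul_ne_top K s) (fun x => by
      obtain ⟨x, rfl⟩ := Submodule.mkQ_surjective _ x
      rw [← map_smul]
      exact (Submodule.Quotient.mk_eq_zero _).2 (Submodule.smul_mem_smul
        (Ideal.pow_le_pow_right hsi.le (Ideal.pow_mem_pow hc i)) trivial)) e N.mkQ
  obtain ⟨f', hf'⟩ := Module.projective_lifting_property N.mkQ f N.mkQ_surjective
  refine ⟨f', fun x => ?_⟩
  have h1 := LinearMap.congr_fun hf x
  rw [← hf'] at h1
  rw [← Submodule.Quotient.mk_eq_zero, ← Submodule.mkQ_apply, map_sub, sub_eq_zero]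
  simpa using h1.symm

end Main

end LocalCM

theorem mainTheorem3 (R : Type u) [CommRing R] [IsLocalRing R]
    (hR : LocalCM.IsCMLocalRing R)
    (M : Type v) [AddCommGroup M] [Module R M] (hM : LocalCM.IsMCM R M)
    (hfin : (LocalCM.indecMCMClasses R
      ((LocalCM.minGens R M : ℝ) * LocalCM.mult R R)).Finite)
    (p : Ideal R) [p.IsPrime] (hp : p ≠ IsLocalRing.maximalIdeal R) :
    Module.Free (Localization.AtPrime p) (LocalizedModule p.primeCompl M) := by
  obtain ⟨hNoeth, hRdepth⟩ := hR
  obtain ⟨hMfin, hMdepth⟩ := hM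
  obtain ⟨d, hd⟩ : ∃ d : ℕ, ringKrullDim R = d := by
    refine ⟨(maximalIdeal R).height.toNat, ?_⟩
    rw [← maximalIdeal_height_eq_ringKrullDim]
    exact_mod_cast
      (ENat.natCast_toNat (Ideal.height_ne_top (Ideal.IsPrime.ne_top inferInstance))).symm
  rw [hd] at hRdepth hMdepth
  have hRd : LocalCM.DepthGE R d R := LocalCM.depthGE_of_depth_eq (by exact_mod_cast hRdepth)
  have hMd : LocalCM.DepthGE R d M := LocalCM.depthGE_of_depth_eq (by exact_mod_cast hMdepth)
  obtain ⟨c, hcm, hcp⟩ := SetLike.exists_of_lt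
    (lt_of_le_of_ne (le_maximalIdeal (Ideal.IsPrime.ne_top ‹p.IsPrime›)) hp)
  set n := LocalCM.minGens R M
  obtain ⟨π, hπ⟩ : ∃ π : (Fin n → R) →ₗ[R] M, Function.Surjective π := by
    obtain ⟨S, hS, hspan⟩ :=
      (Module.Finite.fg_top (R := R) (M := M)).exists_span_finset_card_eq_spanFinrank
    let e := (Finset.equivFinOfCardEq hS).symm
    refine ⟨Fintype.linearCombination R fun i => (e i : M), ?_⟩
    have hrange : Set.range (fun i => (e i : M)) = S := by
      ext x
      exact ⟨fun ⟨i, hi⟩ => hi ▸ (e i).2, fun hx => ⟨e.symm ⟨x, hx⟩, by simp⟩⟩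
    refine LinearMap.range_eq_top.1 ((Fintype.range_linearCombination R _).trans ?_)
    exact hrange ▸ hspan
  let K := LinearMap.ker π
  have hQd : LocalCM.DepthGE R d ((Fin n → R) ⧸ K) :=
    hMd.congr (π.quotKerEquivOfSurjective hπ).symm
  have hKd : LocalCM.DepthGE R d K := .of_exact_left K.injective_subtype K.mkQ_surjective
    (LinearMap.exact_subtype_mkQ K) (hRd.pi n) hQd
  obtain ⟨a, ha⟩ := LocalCM.exists_hilbertSamuel_le K
  -- The bound is kept on the whole Hilbert–Samuel function: it passes to summands termwise and
  -- becomes the multiplicity bound in the limit.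
  let Q : ModuleCat.{u} R → Prop := fun Y => LocalCM.DepthGE R d Y ∧
    ∀ k, LocalCM.hilbertSamuel R Y k ≤ n * LocalCM.hilbertSamuel R R (k + a)
  have hQ : ∀ X A B : ModuleCat.{u} R, (X ≃ₗ[R] A × B) → Module.Finite R X →
      Module.Finite R A → Module.Finite R B → Q X → Q A ∧ Q B := by
    intro X A B e _ _ _ hX
    have h1 := fun k => LocalCM.hilbertSamuel_add_le_of_linearEquiv e k
    refine ⟨⟨hX.1.of_retract (e.symm.toLinearMap ∘ₗ LinearMap.inl R A B)
        (LinearMap.fst R A B ∘ₗ e.toLinearMap) (by ext; simp), fun k => ?_⟩,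
      ⟨hX.1.of_retract (e.symm.toLinearMap ∘ₗ LinearMap.inr R A B)
        (LinearMap.snd R A B ∘ₗ e.toLinearMap) (by ext; simp), fun k => ?_⟩⟩
    · have := hX.2 k; have := h1 k; omega
    · have := hX.2 k; have := h1 k; omega
  have hS : ∀ A : ModuleCat.{u} R, Module.Finite R A → LocalCM.IsIndecomposable R A → Q A →
      Quotient.mk _ A ∈ LocalCM.indecMCMClasses R ((n : ℝ) * LocalCM.mult R R) := by
    intro A _ hI hA
    have := hI.1
    exact ⟨A, ⟨LocalCM.isMCM_of_depthGE hd hA.1, hI, LocalCM.mult_le_mul_mult hA.2⟩, rfl⟩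
  -- A bound, uniform in `i`, on the number of summands of the i-th pushout.
  let b := LocalCM.hilbertSamuel R K 1 + LocalCM.hilbertSamuel R ((Fin n → R) ⧸ K) 1
  have hle : ∀ (i k : ℕ), LocalCM.hilbertSamuel R (SMulPushout K (c ^ i)) k ≤
      LocalCM.hilbertSamuel R K k + LocalCM.hilbertSamuel R ((Fin n → R) ⧸ K) k := fun i k =>
    LocalCM.hilbertSamuel_le_add (SMulPushout.proj_surjective K _) (SMulPushout.exact K _) k
  have hdec := fun i : ℕ => LocalCM.exists_linearEquiv_directSumOfClasses Q hQ hS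
    (ModuleCat.of R (SMulPushout K (c ^ i)))
    ⟨.of_exact (SMulPushout.inr_injective K _) (SMulPushout.proj_surjective K _)
      (SMulPushout.exact K _) hKd hQd, fun k => (hle i k).trans (ha k)⟩
  choose l hl hiso using hdec
  have : Finite (LocalCM.indecMCMClasses R ((n : ℝ) * LocalCM.mult R R)) := hfin
  have : Finite {l : List (LocalCM.indecMCMClasses R ((n : ℝ) * LocalCM.mult R R)) |
      l.length ≤ b} := List.finite_length_le _ b
  obtain ⟨j, f, hf⟩ := LocalCM.exists_extension_pow_smul K hcm
    (T := {l : List (LocalCM.indecMCMClasses R ((n : ℝ) * LocalCM.mult R R)) | l.length ≤ b})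
    (fun i => ⟨l i, (hl i).trans (hle i 1)⟩) (fun i j hij => by
      obtain ⟨e₁⟩ := hiso i
      obtain ⟨e₂⟩ := hiso j
      rw [← show l i = l j from congrArg Subtype.val hij] at e₂
      exact ⟨e₁.trans e₂.symm⟩)
  exact LocalizedModule.free_of_extension p
    (fun h => hcp (Ideal.IsPrime.mem_of_pow_mem ‹_› j h)) π hπ f hf
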